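/- Let $H$ be a finite-dimensional complex Hilbert space. A state (density operator) on $H$ is a positive operator $\rho$ with $\operatorname{Tr}\rho=1$; its support $S(\rho)$ is the orthogonal complement of its null space. A preparation of $\rho$ is a Borel probability measure $P$ on the set of all states on $H$ with barycentre $\int\sigma\,dP(\sigma)=\rho$. For probability measures $P,Q$ on the set of states let $F(P,Q)=\int\sqrt{pq}\,d\mu$ be their classical fidelity (Bhattacharyya or Hellinger overlap), where $p,q$ are the densities of $P,Q$ with respect to the dominating measure $\mu=P+Q$. The compatibility of two states $\rho_A,\rho_B$ is the maximum $$C(\rho_A,\rho_B)=\max\{F(P_A,P_B): P_A \text{ a preparation of }\rho_A,\ P_B\text{ a preparation of }\rho_B\}$$ (a supremum, where it is not known to be attained). Then: 1. If $[\rho_A,\rho_B]=0$, then $C(\rho_A,\rho_B)=F(\rho_A,\rho_B):=\operatorname{Tr}\sqrt{\sqrt{\rho_A}\,\rho_B\sqrt{\rho_A}}$, and the maximum is attained. 2. If $\rho_A$ and $\rho_B$ are incompatible, that is, $S(\rho_A)\cap S(\rho_B)=\{0\}$, then $C(\rho_A,\rho_B)=0$, and the maximum is attained. 3. For every state $\rho$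 and every preparation $P$ of $\rho$, $P$-almost every state $\sigma$ satisfies $S(\sigma)\subseteq S(\rho)$. -/

import Mathlib

open MeasureTheory

noncomputable section

namespace QuantumState

/-- Density operators on a finite-dimensional complex Hilbert space `H`:
positive (hence self-adjoint) operators of trace one. As a subtype it carries the Borel
σ-algebra of the (operator norm) topology. -/
abbrev Density (H : Type*) [NormedAddCommGroup H] [InnerProductSpace ℂ H] : Type _ :=
  {ρ : H →L[ℂ] H // ρ.IsPositive ∧ LinearMap.trace ℂ H (ρ : H →ₗ[ℂ] H) = 1}

variable {H : Type*} [NormedAddCommGroup H] [InnerProductSpace ℂ H]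

/-- The support of a state: the orthogonal complement of its null space. -/
def support (ρ : Density H) : Submodule ℂ H :=
  (LinearMap.ker (ρ.1 : H →ₗ[ℂ] H))ᗮ

/-- Two states are incompatible when their supports meet only in `0`. -/
def Incompatible (ρA ρB : Density H) : Prop :=
  support ρA ⊓ support ρB = ⊥

/-- The fidelity `Tr √(√ρA ρB √ρA)` (not squared); the square roots are those of positive
operators, and the trace of a positive operator is a real number. -/
def fidelity [CompleteSpace H] (ρA ρB : Density H) : ℝ :=
  (LinearMap.trace ℂ H
    (CFC.sqrt (CFC.sqrt ρA.1 * ρB.1 * CFC.sqrt ρA.1) : H →L[ℂ] H)).re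

/-- The preparations of `ρ`: Borel probability measures on the set of density operators
(point masses included) whose barycentre is `ρ`. -/
def preparations (ρ : Density H) : Set (ProbabilityMeasure (Density H)) :=
  {P | ∫ σ, (σ : H →L[ℂ] H) ∂(P : Measure (Density H)) = ρ}

/-- The statistical overlap (classical fidelity, Bhattacharyya coefficient) `∫ √(p q)` of two
probability measures, where `p` and `q` are their densities with respect to the dominating
measure `P + Q`. The value would be the same for every other σ-finite dominating measure. -/
def overlap {X : Type*} [MeasurableSpace X] (P Q : ProbabilityMeasure X) : ℝ :=
  ∫ x, Real.sqrt (((P : Measure X).rnDeriv ((P : Measure X) + (Q : Measure X)) x).toReal *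
    ((Q : Measure X).rnDeriv ((P : Measure X) + (Q : Measure X)) x).toReal)
    ∂((P : Measure X) + (Q : Measure X))

/-- All values of the overlap of a preparation of `ρA` with a preparation of `ρB`. -/
def overlaps (ρA ρB : Density H) : Set ℝ :=
  {c | ∃ P ∈ preparations ρA, ∃ Q ∈ preparations ρB, c = overlap P Q}

/-- The compatibility of two states: the largest overlap of their preparations. The set of
overlaps is non-empty and bounded above by `1`. -/
def compatibility (ρA ρB : Density H) : ℝ :=
  sSup (overlaps ρA ρB)

end QuantumState

end

/-! Everything rests on the expectations `⟨v, σ v⟩`: they are nonnegative, linear in `σ`, and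
average over a preparation of `ρ` to `⟨v, ρ v⟩`. If `ρ v = 0`, this average is zero, so almost
surely `⟨v, σ v⟩ = 0` and, by positivity, `σ v = 0`. Hence the claim on supports (`ae_support_le`).
For incompatible states, no state has its support in both supports, so any two preparations are
mutually singular and overlap in 0. Commuting states share an orthonormal eigenbasis, with
eigenvalues `f` and `g`, and their fidelity is `∑ √(f i * g i)`. Mixing the pure eigenstates with
weights `f` and `g` gives preparations with common atoms and at least this overlap
(`sum_sqrt_le_overlap`). Conversely, measuring any preparations in this basis yields the
distributions `f` and `g`, and by Cauchy–Schwarz a measurement cannot lower the overlap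
(`overlap_le_sum_sqrt`). -/

open MeasureTheory
noncomputable section
namespace QuantumState

/-! ### Classical overlap of probability measures -/

section Overlap

variable {X : Type*} [MeasurableSpace X] (P Q : ProbabilityMeasure X)

theorem absolutelyContinuous_add_left :
    (P : Measure X) ≪ (P : Measure X) + (Q : Measure X) :=
  Measure.absolutelyContinuous_of_le (Measure.le_add_right le_rfl)

theorem absolutelyContinuous_add_right :
    (Q : Measure X) ≪ (P : Measure X) + (Q : Measure X) :=
  Measure.absolutelyContinuous_of_le (Measure.le_add_left le_rfl)

theorem integrable_overlap :
    Integrable (fun x ↦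
      √(((P : Measure X).rnDeriv ((P : Measure X) + (Q : Measure X)) x).toReal *
        ((Q : Measure X).rnDeriv ((P : Measure X) + (Q : Measure X)) x).toReal))
      ((P : Measure X) + (Q : Measure X)) := by
  have hp : Integrable (fun x ↦
    ((P : Measure X).rnDeriv ((P : Measure X) + (Q : Measure X)) x).toReal)
    ((P : Measure X) + (Q : Measure X)) := Measure.integrable_toReal_rnDeriv
  have hq : Integrable (fun x ↦
    ((Q : Measure X).rnDeriv ((P : Measure X) + (Q : Measure X)) x).toReal)
    ((P : Measure X) + (Q : Measure X)) := Measure.integrable_toReal_rnDeriv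
  refine (hp.add hq).mono' (by fun_prop) (Filter.Eventually.of_forall fun x ↦ ?_)
  rw [Real.norm_of_nonneg (Real.sqrt_nonneg _)]
  -- Domination by `p + q`, since `pq ≤ (p + q)²`.
  refine Real.sqrt_le_iff.2 ⟨add_nonneg ENNReal.toReal_nonneg ENNReal.toReal_nonneg, ?_⟩
  simp only [Pi.add_apply]
  nlinarith [@ENNReal.toReal_nonneg
    ((P : Measure X).rnDeriv ((P : Measure X) + (Q : Measure X)) x),
    @ENNReal.toReal_nonneg ((Q : Measure X).rnDeriv ((P : Measure X) + (Q : Measure X)) x)]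

variable {P Q}

theorem overlap_eq_zero_of_mutuallySingular (h : (P : Measure X) ⟂ₘ (Q : Measure X)) :
    overlap P Q = 0 := by
  set μ := (P : Measure X) + (Q : Measure X) with hμ
  obtain ⟨s, hs, hPs, hQs⟩ := h
  have key : ∀ (R : ProbabilityMeasure X) (t : Set X), MeasurableSet t → (R : Measure X) ≪ μ →
      (R : Measure X) t = 0 → ∀ᵐ x ∂μ, x ∈ t → (R : Measure X).rnDeriv μ x = 0 := by
    intro R t ht hR h0
    rw [← Measure.setLIntegral_rnDeriv hR, lintegral_eq_zero_iff (Measure.measurable_rnDeriv _ _)]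
      at h0
    exact (ae_restrict_iff' ht).1 h0
  refine integral_eq_zero_of_ae ?_
  filter_upwards [key P s hs (absolutelyContinuous_add_left P Q) hPs,
    key Q sᶜ hs.compl (absolutelyContinuous_add_right P Q) hQs] with x h1 h2
  by_cases hx : x ∈ s
  · simp [← hμ, h1 hx]
  · simp [← hμ, h2 hx]

/-- A finite family of atoms bounds the overlap from below. -/
theorem sum_sqrt_le_overlap [MeasurableSingletonClass X] {ι : Type*} [Fintype ι] {x : ι → X}
    (hx : Function.Injective x) :
    ∑ i, √((P : Measure X).real {x i} * (Q : Measure X).real {x i}) ≤ overlap P Q := by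
  set μ := (P : Measure X) + (Q : Measure X) with hμ
  have key : ∀ (R : ProbabilityMeasure X), (R : Measure X) ≪ μ → ∀ y,
      (R : Measure X).real {y} = μ.real {y} * ((R : Measure X).rnDeriv μ y).toReal := by
    intro R hR y
    rw [measureReal_def, ← Measure.setLIntegral_rnDeriv hR, lintegral_singleton,
      ENNReal.toReal_mul, mul_comm, measureReal_def]
  set f : X → ℝ := fun y ↦ √(((P : Measure X).rnDeriv μ y).toReal *
        ((Q : Measure X).rnDeriv μ y).toReal) with hf
  calc ∑ i, √((P : Measure X).real {x i} * (Q : Measure X).real {x i})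
      = ∑ i, ∫ y in {x i}, f y ∂μ := by
        refine Finset.sum_congr rfl fun i _ ↦ ?_
        -- Both atoms carry the same factor `μ {x i}`, which leaves the square root.
        rw [integral_singleton, key P (absolutelyContinuous_add_left P Q),
          key Q (absolutelyContinuous_add_right P Q), mul_mul_mul_comm,
          Real.sqrt_mul (mul_self_nonneg _), Real.sqrt_mul_self measureReal_nonneg, smul_eq_mul]
    _ = ∫ y in ⋃ i, {x i}, f y ∂μ := by
        rw [integral_iUnion_fintype (fun i ↦ measurableSet_singleton _)]
        · intro i j hij
          simpa [Function.onFun] using hx.ne hij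
        · exact fun i ↦ (integrable_overlap P Q).integrableOn
    _ ≤ overlap P Q := setIntegral_le_integral (integrable_overlap P Q)
        (Filter.Eventually.of_forall fun _ ↦ Real.sqrt_nonneg _)

/-- Cauchy–Schwarz for `√f` and `√g`, which lie in L². -/
theorem integral_sqrt_mul_sqrt_le {μ : Measure X} {f g : X → ℝ} (hf0 : 0 ≤ f) (hg0 : 0 ≤ g)
    (hf : Integrable f μ) (hg : Integrable g μ) :
    ∫ x, √(f x) * √(g x) ∂μ ≤ √((∫ x, f x ∂μ) * ∫ x, g x ∂μ) := by
  have key : ∀ h : X → ℝ, 0 ≤ h → Integrable h μ →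
      MemLp (fun x ↦ √(h x)) (ENNReal.ofReal 2) μ := by
    intro h h0 hh
    rw [ENNReal.ofReal_ofNat, memLp_two_iff_integrable_sq
      (Real.continuous_sqrt.comp_aestronglyMeasurable hh.aestronglyMeasurable)]
    simpa only [Real.sq_sqrt (h0 _)] using hh
  refine (integral_mul_le_Lp_mul_Lq_of_nonneg Real.HolderConjugate.two_two
    (Filter.Eventually.of_forall fun _ ↦ Real.sqrt_nonneg _)
    (Filter.Eventually.of_forall fun _ ↦ Real.sqrt_nonneg _)
    (key f hf0 hf) (key g hg0 hg)).trans_eq ?_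
  simp only [Real.rpow_two, Real.sq_sqrt (hf0 _), Real.sq_sqrt (hg0 _)]
  rw [← Real.sqrt_eq_rpow, ← Real.sqrt_eq_rpow, Real.sqrt_mul (integral_nonneg hf0)]

/-- Measuring a partition of unity does not decrease the overlap. -/
theorem overlap_le_sum_sqrt {ι : Type*} [Fintype ι] {s : ι → X → ℝ} (hs0 : ∀ i, 0 ≤ s i)
    (hs1 : ∀ x, ∑ i, s i x = 1) (hP : ∀ i, Integrable (s i) (P : Measure X))
    (hQ : ∀ i, Integrable (s i) (Q : Measure X)) :
    overlap P Q ≤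
      ∑ i, √((∫ x, s i x ∂(P : Measure X)) * ∫ x, s i x ∂(Q : Measure X)) := by
  set μ := (P : Measure X) + (Q : Measure X) with hμ
  have hPμ := absolutelyContinuous_add_left P Q
  have hQμ := absolutelyContinuous_add_right P Q
  set p : X → ℝ := fun x ↦ ((P : Measure X).rnDeriv μ x).toReal with hp
  set q : X → ℝ := fun x ↦ ((Q : Measure X).rnDeriv μ x).toReal with hq
  have hp0 : 0 ≤ p := fun _ ↦ ENNReal.toReal_nonneg
  have hq0 : 0 ≤ q := fun _ ↦ ENNReal.toReal_nonneg
  have hip : ∀ i, Integrable (fun x ↦ p x * s i x) μ := fun i ↦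
    (integrable_rnDeriv_smul_iff hPμ).2 (hP i)
  have hiq : ∀ i, Integrable (fun x ↦ q x * s i x) μ := fun i ↦
    (integrable_rnDeriv_smul_iff hQμ).2 (hQ i)
  -- Summed over `i`, the right side is `√(pq)`, because the `s i` add up to 1.
  have hsplit : ∀ x i, √(p x * s i x) * √(q x * s i x) = √(p x * q x) * s i x := fun x i ↦ by
    rw [← Real.sqrt_mul (mul_nonneg (hp0 x) (hs0 i x)), mul_mul_mul_comm,
      Real.sqrt_mul (mul_nonneg (hp0 x) (hq0 x)), Real.sqrt_mul_self (hs0 i x)]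
  have hs_le : ∀ i x, s i x ≤ 1 := fun i x ↦
    (Finset.single_le_sum (fun j _ ↦ hs0 j x) (Finset.mem_univ i)).trans_eq (hs1 x)
  have hint : ∀ i, Integrable (fun x ↦ √(p x * s i x) * √(q x * s i x)) μ := by
    intro i
    refine (integrable_overlap P Q).mono'
      ((Real.continuous_sqrt.comp_aestronglyMeasurable (hip i).aestronglyMeasurable).mul
        (Real.continuous_sqrt.comp_aestronglyMeasurable (hiq i).aestronglyMeasurable))
      (Filter.Eventually.of_forall fun x ↦ ?_)
    rw [hsplit, Real.norm_of_nonneg (mul_nonneg (Real.sqrt_nonneg _) (hs0 i x))]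
    exact mul_le_of_le_one_right (Real.sqrt_nonneg _) (hs_le i x)
  calc overlap P Q = ∫ x, ∑ i, √(p x * s i x) * √(q x * s i x) ∂μ := by
        refine integral_congr_ae (Filter.Eventually.of_forall fun x ↦ ?_)
        simp only [hsplit, ← Finset.mul_sum, hs1, mul_one]
        rfl
    _ = ∑ i, ∫ x, √(p x * s i x) * √(q x * s i x) ∂μ := integral_finsetSum _ fun i _ ↦ hint i
    _ ≤ ∑ i, √((∫ x, p x * s i x ∂μ) * ∫ x, q x * s i x ∂μ) := Finset.sum_le_sum fun i _ ↦
        integral_sqrt_mul_sqrt_le (fun x ↦ mul_nonneg (hp0 x) (hs0 i x))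
          (fun x ↦ mul_nonneg (hq0 x) (hs0 i x)) (hip i) (hiq i)
    _ = _ := by
        refine Finset.sum_congr rfl fun i _ ↦ ?_
        have h1 : ∫ x, p x * s i x ∂μ = ∫ x, s i x ∂(P : Measure X) :=
          integral_rnDeriv_smul hPμ
        have h2 : ∫ x, q x * s i x ∂μ = ∫ x, s i x ∂(Q : Measure X) :=
          integral_rnDeriv_smul hQμ
        rw [h1, h2]

end Overlap


/-! ### Expectations, supports and incompatible states -/

variable {H : Type*} [NormedAddCommGroup H] [InnerProductSpace ℂ H]

/-- `⟨v, T v⟩` is the squared norm of `√T v`. -/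
theorem apply_eq_zero_of_inner_eq_zero [CompleteSpace H] {T : H →L[ℂ] H} (hT : T.IsPositive)
    {v : H} (h : inner ℂ v (T v) = 0) : T v = 0 := by
  have hT0 : 0 ≤ T := (ContinuousLinearMap.nonneg_iff_isPositive T).2 hT
  have hS : (CFC.sqrt T).IsPositive :=
    (ContinuousLinearMap.nonneg_iff_isPositive _).1 (CFC.sqrt_nonneg T)
  have hSS : ∀ w, CFC.sqrt T (CFC.sqrt T w) = T w := fun w ↦
    congrArg (fun A : H →L[ℂ] H ↦ A w) (CFC.sqrt_mul_sqrt_self T hT0)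
  rw [← hSS, ← hS.inner_left_eq_inner_right, inner_self_eq_zero] at h
  rw [← hSS, h, map_zero]

theorem Density.ne_zero (ρ : Density H) : (ρ : H →L[ℂ] H) ≠ 0 := fun h ↦ by
  have := ρ.2.2
  simp [h] at this

/-- The Bochner integral of a non-integrable function is 0 by convention, and a state is never 0. -/
theorem integrable_of_mem_preparations {ρ : Density H} {P : ProbabilityMeasure (Density H)}
    (hP : P ∈ preparations ρ) :
    Integrable (fun σ : Density H ↦ (σ : H →L[ℂ] H)) (P : Measure (Density H)) :=
  .of_integral_ne_zero (by rw [hP]; exact ρ.ne_zero)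

/-- The expectation `⟨v, σ v⟩` as a continuous real-linear functional of `σ`. -/
def expectation (v : H) : (H →L[ℂ] H) →L[ℝ] ℝ :=
  Complex.reCLM ∘L ((innerSL ℂ v) ∘L (ContinuousLinearMap.apply ℂ H v)).restrictScalars ℝ

theorem expectation_apply (v : H) (T : H →L[ℂ] H) : expectation v T = (inner ℂ v (T v)).re := rfl

theorem ofReal_expectation {T : H →L[ℂ] H} (hT : T.IsPositive) (v : H) :
    ((expectation v T : ℝ) : ℂ) = inner ℂ v (T v) := by
  have := hT.inner_nonneg_right v
  rw [expectation_apply]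
  exact (Complex.eq_re_of_ofReal_le (r := 0) (by simpa using this)).symm

theorem expectation_nonneg {T : H →L[ℂ] H} (hT : T.IsPositive) (v : H) : 0 ≤ expectation v T :=
  hT.re_inner_nonneg_right v

theorem sum_expectation {ι : Type*} [Fintype ι] (b : OrthonormalBasis ι ℂ H) (σ : Density H) :
    ∑ i, expectation (b i) σ = 1 := by
  have h := σ.2.2
  rw [LinearMap.trace_eq_sum_inner _ b] at h
  have h' := congrArg Complex.re h
  simpa [expectation_apply] using h'

theorem integrable_expectation {ρ : Density H} {P : ProbabilityMeasure (Density H)}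
    (hP : P ∈ preparations ρ) (v : H) :
    Integrable (fun σ : Density H ↦ expectation v σ) (P : Measure (Density H)) :=
  (expectation v).integrable_comp (integrable_of_mem_preparations hP)

section

variable [FiniteDimensional ℂ H]

theorem integral_expectation {ρ : Density H} {P : ProbabilityMeasure (Density H)}
    (hP : P ∈ preparations ρ) (v : H) :
    ∫ σ : Density H, expectation v σ ∂(P : Measure (Density H)) = expectation v ρ := by
  have : CompleteSpace (H →L[ℂ] H) := FiniteDimensional.complete ℂ _
  rw [(expectation v).integral_comp_comm (integrable_of_mem_preparations hP), hP]

theorem ae_apply_eq_zero [CompleteSpace H] {ρ : Density H} {P : ProbabilityMeasure (Density H)}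
    (hP : P ∈ preparations ρ) {v : H} (hv : (ρ : H →L[ℂ] H) v = 0) :
    ∀ᵐ σ : Density H ∂(P : Measure (Density H)), (σ : H →L[ℂ] H) v = 0 := by
  have h0 := integral_expectation hP v
  rw [expectation_apply, hv, inner_zero_right, Complex.zero_re, integral_eq_zero_iff_of_nonneg
    (fun σ ↦ expectation_nonneg σ.2.1 v) (integrable_expectation hP v)] at h0
  filter_upwards [h0] with σ hσ
  refine apply_eq_zero_of_inner_eq_zero σ.2.1 ?_
  rw [← ofReal_expectation σ.2.1, hσ]
  simp

theorem ae_support_le [CompleteSpace H] {ρ : Density H} {P : ProbabilityMeasure (Density H)}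
    (hP : P ∈ preparations ρ) :
    ∀ᵐ σ ∂(P : Measure (Density H)), support σ ≤ support ρ := by
  -- A finite basis of the kernel leaves only finitely many null sets to discard.
  let b := Module.finBasis ℂ (LinearMap.ker (ρ.1 : H →ₗ[ℂ] H))
  have h : ∀ᵐ σ : Density H ∂(P : Measure (Density H)), ∀ i, (σ : H →L[ℂ] H) (b i) = 0 :=
    ae_all_iff.2 fun i ↦ ae_apply_eq_zero hP (b i).2
  filter_upwards [h] with σ hσ
  refine Submodule.orthogonal_le fun v hv ↦ ?_
  have h0 : (σ.1 : H →ₗ[ℂ] H) ∘ₗ (LinearMap.ker (ρ.1 : H →ₗ[ℂ] H)).subtype = 0 :=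
    b.ext fun i ↦ by simpa using hσ i
  exact LinearMap.congr_fun h0 ⟨v, hv⟩

theorem support_ne_bot (ρ : Density H) : support ρ ≠ ⊥ := fun h ↦ by
  rw [support, Submodule.orthogonal_eq_bot_iff, LinearMap.ker_eq_top] at h
  exact ρ.ne_zero (ContinuousLinearMap.coe_injective h)

theorem mutuallySingular_of_incompatible [CompleteSpace H] {ρA ρB : Density H}
    (h : Incompatible ρA ρB) {P Q : ProbabilityMeasure (Density H)}
    (hP : P ∈ preparations ρA) (hQ : Q ∈ preparations ρB) :
    (P : Measure (Density H)) ⟂ₘ (Q : Measure (Density H)) := by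
  -- The two sets are null for `P` and `Q` respectively. They cover all states, since a state
  -- outside both would have support 0.
  refine Measure.MutuallySingular.mk (s := {σ | ¬ support σ ≤ support ρA})
    (t := {σ | ¬ support σ ≤ support ρB}) (ae_support_le hP) (ae_support_le hQ) ?_
  intro σ _
  by_contra! hσ
  simp only [Set.mem_union, Set.mem_ofPred_eq, not_or, not_not] at hσ
  exact support_ne_bot σ (le_bot_iff.1 ((le_inf hσ.1 hσ.2).trans_eq h))

theorem dirac_mem_preparations (ρ : Density H) :
    (⟨Measure.dirac ρ, inferInstance⟩ : ProbabilityMeasure (Density H)) ∈ preparations ρ :=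
  integral_dirac _ _

theorem overlaps_eq_singleton_zero [CompleteSpace H] {ρA ρB : Density H}
    (h : Incompatible ρA ρB) : overlaps ρA ρB = {0} := by
  refine Set.eq_singleton_iff_unique_mem.2 ⟨⟨_, dirac_mem_preparations ρA, _,
    dirac_mem_preparations ρB, ?_⟩, ?_⟩
  · exact (overlap_eq_zero_of_mutuallySingular (mutuallySingular_of_incompatible h
      (dirac_mem_preparations ρA) (dirac_mem_preparations ρB))).symm
  · rintro c ⟨P, hP, Q, hQ, rfl⟩
    exact overlap_eq_zero_of_mutuallySingular (mutuallySingular_of_incompatible h hP hQ)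

end

/-- The operator with eigenvalues `f i` on the orthonormal basis `b`. -/
def diagonal {ι : Type*} [Fintype ι] (b : OrthonormalBasis ι ℂ H) (f : ι → ℝ) : H →L[ℂ] H :=
  ∑ i, (f i : ℂ) • InnerProductSpace.rankOne ℂ (b i) (b i)

/-! ### States diagonal in a common orthonormal basis -/

section Diagonal

variable {ι : Type*} [Fintype ι] (b : OrthonormalBasis ι ℂ H)

theorem diagonal_apply_basis (f : ι → ℝ) (i : ι) : diagonal b f (b i) = (f i : ℂ) • b i := by
  classical
  simp [diagonal, OrthonormalBasis.inner_eq_ite, ite_smul]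

theorem eq_diagonal {T : H →L[ℂ] H} {f : ι → ℝ} (h : ∀ i, T (b i) = (f i : ℂ) • b i) :
    T = diagonal b f :=
  ContinuousLinearMap.coe_injective <| b.toBasis.ext fun i ↦ by
    simp [h, diagonal_apply_basis]

theorem isPositive_diagonal {f : ι → ℝ} (hf : 0 ≤ f) : (diagonal b f).IsPositive :=
  ContinuousLinearMap.isPositive_sum _ fun i _ ↦
    (InnerProductSpace.isPositive_rankOne_self _).smul_of_nonneg (by exact_mod_cast hf i)

theorem diagonal_mul_diagonal (f g : ι → ℝ) :
    diagonal b f * diagonal b g = diagonal b (f * g) :=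
  eq_diagonal b fun i ↦ by
    rw [mul_apply_eq_comp, diagonal_apply_basis, map_smul, diagonal_apply_basis, smul_smul,
      Pi.mul_apply, Complex.ofReal_mul, mul_comm]

theorem trace_diagonal (f : ι → ℝ) :
    LinearMap.trace ℂ H (diagonal b f : H →ₗ[ℂ] H) = ((∑ i, f i : ℝ) : ℂ) := by
  rw [LinearMap.trace_eq_sum_inner _ b, Complex.ofReal_sum]
  refine Finset.sum_congr rfl fun i _ ↦ ?_
  rw [ContinuousLinearMap.coe_coe, diagonal_apply_basis, inner_smul_right]
  simp

theorem sqrt_diagonal [CompleteSpace H] {f : ι → ℝ} (hf : 0 ≤ f) :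
    CFC.sqrt (diagonal b f) = diagonal b (fun i ↦ √(f i)) :=
  CFC.sqrt_unique (by rw [diagonal_mul_diagonal]; congr 1; ext i; exact Real.mul_self_sqrt (hf i))
    ((ContinuousLinearMap.nonneg_iff_isPositive _).2
      (isPositive_diagonal b fun i ↦ Real.sqrt_nonneg _))

theorem fidelity_eq_sum [CompleteSpace H] {ρA ρB : Density H} {f g : ι → ℝ} (hf : 0 ≤ f)
    (hg : 0 ≤ g) (hA : ρA.1 = diagonal b f) (hB : ρB.1 = diagonal b g) :
    fidelity ρA ρB = ∑ i, √(f i * g i) := by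
  have h : CFC.sqrt ρA.1 * ρB.1 * CFC.sqrt ρA.1 = diagonal b (f * g) := by
    rw [hA, hB, sqrt_diagonal b hf, diagonal_mul_diagonal, diagonal_mul_diagonal]
    congr 1
    ext i
    simp only [Pi.mul_apply]
    rw [mul_right_comm, Real.mul_self_sqrt (hf i)]
  rw [fidelity, h, sqrt_diagonal b (mul_nonneg hf hg), trace_diagonal, Complex.ofReal_re]
  rfl

/-- The pure state along a vector of an orthonormal basis. -/
def pureState (i : ι) : Density H :=
  ⟨InnerProductSpace.rankOne ℂ (b i) (b i), InnerProductSpace.isPositive_rankOne_self _, by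
    have := b.toBasis.finiteDimensional_of_finite
    rw [InnerProductSpace.trace_rankOne]
    simp⟩

/-- Keeps the atoms of a mixture distinct, so that each has exactly its own weight. -/
theorem pureState_injective : Function.Injective (pureState b) := by
  classical
  intro i j hij
  have h := congrArg (fun σ : Density H ↦ σ.1 (b i)) hij
  by_contra hne
  simp [pureState, Ne.symm hne] at h
  exact b.toBasis.ne_zero i (by simpa using h)

/-- The mixture of the pure states of an orthonormal basis with weights `f`. -/
def mixture (f : ι → ℝ) : Measure (Density H) :=
  ∑ i, ENNReal.ofReal (f i) • Measure.dirac (pureState b i)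

theorem isProbabilityMeasure_mixture {f : ι → ℝ} (hf : 0 ≤ f) (h1 : ∑ i, f i = 1) :
    IsProbabilityMeasure (mixture b f) := ⟨by
  simp [mixture, ← ENNReal.ofReal_sum_of_nonneg fun i _ ↦ hf i, h1]⟩

theorem integral_mixture [FiniteDimensional ℂ H] {f : ι → ℝ} (hf : 0 ≤ f) :
    ∫ σ : Density H, (σ : H →L[ℂ] H) ∂(mixture b f) = diagonal b f := by
  rw [mixture, integral_finsetSum_measure]
  · refine Finset.sum_congr rfl fun i _ ↦ ?_
    rw [integral_smul_measure, integral_dirac, ENNReal.toReal_ofReal (hf i)]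
    rfl
  · intro i _
    exact (integrable_dirac (by simp)).smul_measure ENNReal.ofReal_ne_top

theorem mixture_real_singleton {f : ι → ℝ} (hf : 0 ≤ f) (i : ι) :
    (mixture b f).real {pureState b i} = f i := by
  classical
  have : mixture b f {pureState b i} = ENNReal.ofReal (f i) := by
    simp only [mixture, Measure.coe_finsetSum, Finset.sum_apply, Measure.smul_apply,
      Measure.dirac_apply, smul_eq_mul, Set.indicator_apply, Set.mem_singleton_iff,
      (pureState_injective b).eq_iff, Pi.one_apply, mul_ite, mul_one, mul_zero]
    simp
  rw [measureReal_def, this, ENNReal.toReal_ofReal (hf i)]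

theorem sum_eq_one {ρ : Density H} {f : ι → ℝ} (h : ρ.1 = diagonal b f) : ∑ i, f i = 1 := by
  have := ρ.2.2
  rw [h, trace_diagonal] at this
  exact_mod_cast this

theorem expectation_diagonal (f : ι → ℝ) (i : ι) : expectation (b i) (diagonal b f) = f i := by
  simp [expectation_apply, diagonal_apply_basis]

theorem isGreatest_overlaps_of_diagonal [FiniteDimensional ℂ H] {ρA ρB : Density H} {f g : ι → ℝ}
    (hf : 0 ≤ f) (hg : 0 ≤ g) (hA : ρA.1 = diagonal b f) (hB : ρB.1 = diagonal b g) :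
    IsGreatest (overlaps ρA ρB) (∑ i, √(f i * g i)) := by
  have upper : ∀ P ∈ preparations ρA, ∀ Q ∈ preparations ρB,
      overlap P Q ≤ ∑ i, √(f i * g i) := by
    intro P hP Q hQ
    -- The partition of unity consists of the outcome probabilities of the measurement in the basis
    -- `b`.
    refine (overlap_le_sum_sqrt (s := fun i (σ : Density H) ↦ expectation (b i) σ)
      (fun i σ ↦ expectation_nonneg σ.2.1 _) (sum_expectation b)
      (fun i ↦ integrable_expectation hP _) (fun i ↦ integrable_expectation hQ _)).trans_eq ?_
    refine Finset.sum_congr rfl fun i _ ↦ ?_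
    rw [integral_expectation hP, integral_expectation hQ, hA, hB, expectation_diagonal,
      expectation_diagonal]
  refine ⟨?_, ?_⟩
  · let P : ProbabilityMeasure (Density H) :=
      ⟨mixture b f, isProbabilityMeasure_mixture b hf (sum_eq_one b hA)⟩
    let Q : ProbabilityMeasure (Density H) :=
      ⟨mixture b g, isProbabilityMeasure_mixture b hg (sum_eq_one b hB)⟩
    have hP : P ∈ preparations ρA := (integral_mixture b hf).trans hA.symm
    have hQ : Q ∈ preparations ρB := (integral_mixture b hg).trans hB.symm
    refine ⟨P, hP, Q, hQ, le_antisymm ?_ (upper P hP Q hQ)⟩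
    refine Eq.trans_le ?_ (sum_sqrt_le_overlap (P := P) (Q := Q) (pureState_injective b))
    exact Finset.sum_congr rfl fun i _ ↦ by
      rw [← mixture_real_singleton b hf i, ← mixture_real_singleton b hg i]; rfl
  · rintro c ⟨P, hP, Q, hQ, rfl⟩
    exact upper P hP Q hQ

end Diagonal

theorem exists_diagonal_of_commute [FiniteDimensional ℂ H] {ρA ρB : Density H}
    (h : Commute (ρA : H →L[ℂ] H) (ρB : H →L[ℂ] H)) :
    ∃ (n : ℕ) (b : OrthonormalBasis (Fin n) ℂ H) (f g : Fin n → ℝ), 0 ≤ f ∧ 0 ≤ g ∧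
      ρA.1 = diagonal b f ∧ ρB.1 = diagonal b g := by
  classical
  have hA := ρA.2.1.isSymmetric
  have hB := ρB.2.1.isSymmetric
  have hc : Commute (ρA.1 : H →ₗ[ℂ] H) (ρB.1 : H →ₗ[ℂ] H) :=
    congrArg (fun T : H →L[ℂ] H ↦ (T : H →ₗ[ℂ] H)) h
  have hint := LinearMap.IsSymmetric.directSum_isInternal_of_commute hA hB hc
  -- The joint eigenspaces are indexed by all of `ℂ × ℂ`; only finitely many are nonzero, and these
  -- alone are kept.
  have hV := DirectSum.isInternal_ne_bot_iff.2 hint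
  have hV' := (LinearMap.IsSymmetric.orthogonalFamily_eigenspace_inf_eigenspace hA hB).comp
    (Subtype.val_injective (p := fun i : ℂ × ℂ ↦ Module.End.eigenspace (ρA.1 : H →ₗ[ℂ] H) i.2 ⊓
      Module.End.eigenspace (ρB.1 : H →ₗ[ℂ] H) i.1 ≠ ⊥))
  have : Fintype {i : ℂ × ℂ // Module.End.eigenspace (ρA.1 : H →ₗ[ℂ] H) i.2 ⊓
      Module.End.eigenspace (ρB.1 : H →ₗ[ℂ] H) i.1 ≠ ⊥} :=
    (WellFoundedGT.finite_ne_bot_of_iSupIndep hint.submodule_iSupIndep).fintype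
  let b := hV.subordinateOrthonormalBasis rfl hV'
  let k := fun i ↦ hV.subordinateOrthonormalBasisIndex rfl i hV'
  have hb : ∀ i, b i ∈ Module.End.eigenspace (ρA.1 : H →ₗ[ℂ] H) (k i).1.2 ⊓
      Module.End.eigenspace (ρB.1 : H →ₗ[ℂ] H) (k i).1.1 := fun i ↦
    hV.subordinateOrthonormalBasis_subordinate rfl i hV'
  -- The complex eigenvalue equals the expectation at the unit vector `b i`, hence is real and
  -- nonnegative.
  have key : ∀ (ρ : Density H) (i) (z : ℂ), b i ∈ Module.End.eigenspace (ρ.1 : H →ₗ[ℂ] H) z →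
      ρ.1 (b i) = (expectation (b i) ρ.1 : ℂ) • b i := by
    intro ρ i z hz
    have hz' : ρ.1 (b i) = z • b i := Module.End.mem_eigenspace_iff.1 hz
    rw [ofReal_expectation ρ.2.1, hz', inner_smul_right]
    simp
  exact ⟨_, b, fun i ↦ expectation (b i) ρA.1, fun i ↦ expectation (b i) ρB.1,
    fun i ↦ expectation_nonneg ρA.2.1 _, fun i ↦ expectation_nonneg ρB.2.1 _,
    eq_diagonal b fun i ↦ key ρA i _ (hb i).1, eq_diagonal b fun i ↦ key ρB i _ (hb i).2⟩

end QuantumState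
end

theorem theorem1 {H : Type*} [NormedAddCommGroup H] [InnerProductSpace ℂ H] [CompleteSpace H]
    [FiniteDimensional ℂ H] (ρA ρB : QuantumState.Density H) :
    (Commute (ρA : H →L[ℂ] H) (ρB : H →L[ℂ] H) →
      QuantumState.compatibility ρA ρB = QuantumState.fidelity ρA ρB ∧
      IsGreatest (QuantumState.overlaps ρA ρB) (QuantumState.compatibility ρA ρB)) ∧
    (QuantumState.Incompatible ρA ρB →
      QuantumState.compatibility ρA ρB = 0 ∧
      IsGreatest (QuantumState.overlaps ρA ρB) (QuantumState.compatibility ρA ρB)) ∧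
    (∀ ρ : QuantumState.Density H, ∀ P ∈ QuantumState.preparations ρ,
      ∀ᵐ σ ∂(P : MeasureTheory.Measure (QuantumState.Density H)),
        QuantumState.support σ ≤ QuantumState.support ρ) := by
  refine ⟨fun h ↦ ?_, fun h ↦ ?_, fun ρ P hP ↦ QuantumState.ae_support_le hP⟩
  · obtain ⟨n, b, f, g, hf, hg, hA, hB⟩ := QuantumState.exists_diagonal_of_commute h
    have hmax := QuantumState.isGreatest_overlaps_of_diagonal b hf hg hA hB
    have hC : QuantumState.compatibility ρA ρB = ∑ i, √(f i * g i) := hmax.csSup_eq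
    exact ⟨hC.trans (QuantumState.fidelity_eq_sum b hf hg hA hB).symm, hC ▸ hmax⟩
  · have h0 := QuantumState.overlaps_eq_singleton_zero h
    have hC : QuantumState.compatibility ρA ρB = 0 := by
      rw [QuantumState.compatibility, h0, csSup_singleton]
    exact ⟨hC, by rw [hC, h0]; exact isGreatest_singleton⟩
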